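/- Let $\mathbf C$ be an essentially small category with pushouts. Write $\mathbf{KOrd}$ for the category of (small) compact ordered spaces, i.e. compact spaces with a partial order $\le$ that is closed in the square, with continuous order-preserving maps. A square of functions between ordered sets consisting of $f\colon A\to B$, $g\colon A\to C$, $u\colon B\to D$, $v\colon C\to D$ (with $uf\le vg$) has the \emph{interpolation property} if for all $b\in B$, $c\in C$ with $u(b)\le v(c)$ there is $a\in A$ with $b\le f(a)$ and $g(a)\le c$. A \emph{polyadic compact ordered space} over $\mathbf C$ is a functor $\mathcal S\colon\mathbf C^{\mathrm{op}}\to\mathbf{KOrd}$ that sends pushout squares to squares with the interpolation property and such that, for every morphism $\sigma$ of $\mathbf C$, the map $\mathcal S(\sigma)$ is bounded (the direct image of every up-set is an up-set). View an ind-object $X$ of $\mathbf C$ as a presheaf of sets $n\mapsto X^n=\operatorname{Hom}(n,X)$ on $\mathbf C$; an \emph{$X$-type} of $\mathcal S$ is a natural transformation $x\colon X\to\mathcal S$. An $X$-type $x$ is an \emph{$\omega$-saturated model} if for every morphism $f\colon n\to m$ of $\mathbf C$ the naturality square formed by $x_m\colon X^m\to\mathcal S(m)$, $X(f)\colon X^m\to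 X^n$, $\mathcal S(f)\colon\mathcal S(m)\to\mathcal S(n)$, $x_n\colon X^n\to\mathcal S(n)$ has the interpolation property, where $X^n$ is discretely ordered; that is, whenever $t\in\mathcal S(m)$ and $p\in X^n$ satisfy $\mathcal S(f)(t)\le x_n(p)$, there is $q\in X^m$ with $X(f)(q)=p$ and $t\le x_m(q)$. \textbf{Theorem (Gödel's completeness theorem).} Let $\mathcal S$ be a polyadic compact ordered space over $\mathbf C$, let $X$ be an ind-object of $\mathbf C$ and let $x\colon X\to\mathcal S$ be an $X$-type. Then $x$ is realized by an $\omega$-saturated model: there exist an ind-object $Y$ of $\mathbf C$, an $\omega$-saturated model $y\colon Y\to\mathcal S$ and an elementary embedding from $x$ to $y$, i.e. a morphism $h\colon X\to Y$ of ind-objects with $y\circ h=x$. -/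

import Mathlib

open CategoryTheory Opposite

universe v u

/-- A compact ordered space: a compact topological space with a partial order that is closed as a
subset of the square (the space is then automatically Hausdorff). -/
structure KOrd : Type (u + 1) where
  /-- Bundle a type with its structure of compact ordered space. -/
  of ::
  /-- The underlying type. -/
  carrier : Type u
  [top : TopologicalSpace carrier]
  [order : PartialOrder carrier]
  [compact : CompactSpace carrier]
  [closedOrder : OrderClosedTopology carrier]

namespace KOrd

attribute [instance] KOrd.top KOrd.order KOrd.compact KOrd.closedOrder

instance : CoeSort KOrd.{u} (Type u) :=
  ⟨KOrd.carrier⟩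

/-- Morphisms of compact ordered spaces: continuous order-preserving maps. -/
@[ext]
structure Hom (A B : KOrd.{u}) where
  /-- The underlying continuous order-preserving map. -/
  hom' : A →Co B

instance : Category KOrd.{u} where
  Hom A B := Hom A B
  id A := ⟨ContinuousOrderHom.id A⟩
  comp f g := ⟨g.hom'.comp f.hom'⟩

instance : ConcreteCategory KOrd.{u} (fun A B => A →Co B) where
  hom := Hom.hom'
  ofHom := Hom.mk

end KOrd

/-- A square of functions between ordered sets

```
      g
  A ----> C
  |       |
f |       | v
  v       v
  B ----> D
      u
```

has the interpolation property if `u b ≤ v c` implies that there is an interpolant `a : A`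
with `b ≤ f a` and `g a ≤ c`. -/
def HasInterpolation {A B C D : Type*} [LE B] [LE C] [LE D]
    (f : A → B) (g : A → C) (u : B → D) (v : C → D) : Prop :=
  ∀ (b : B) (c : C), u b ≤ v c → ∃ a : A, b ≤ f a ∧ g a ≤ c

/-- A function between ordered sets is bounded if the direct image of every up-set is an up-set. -/
def IsBoundedMap {A B : Type*} [LE A] [LE B] (f : A → B) : Prop :=
  ∀ U : Set A, IsUpperSet U → IsUpperSet (f '' U)

section Polyadic

variable {C : Type u} [Category.{v} C]

/-- A presheaf of compact ordered spaces is a polyadic compact ordered space if it sends pushout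
squares to squares with the interpolation property and all morphisms to bounded maps. -/
structure IsPolyadic (S : Cᵒᵖ ⥤ KOrd.{v}) : Prop where
  interpolation : ∀ {k m n p : C} {f : k ⟶ m} {g : k ⟶ n} {i : m ⟶ p} {j : n ⟶ p},
    IsPushout f g i j →
      HasInterpolation (S.map i.op) (S.map j.op) (S.map f.op) (S.map g.op)
  bounded : ∀ {n m : C} (f : n ⟶ m), IsBoundedMap (S.map f.op)

/-- For an ind-object `X` of `C`, an `X`-type of `S` is a natural transformation `X → S`, where `X`
is seen as a presheaf of sets on `C`. -/
abbrev TypeOver (S : Cᵒᵖ ⥤ KOrd.{v}) (X : Ind C) :=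
  (Ind.inclusion C).obj X ⟶ S ⋙ forget KOrd.{v}

/-- The set `Xⁿ` of `n`-points of an ind-object `X`, equipped with the discrete order. -/
structure Pts (X : Ind C) (n : C) : Type v where
  /-- The underlying element of the presheaf `X` at `n`. -/
  pt : ((Ind.inclusion C).obj X).obj (op n)

/-- The order of `Xⁿ` is the discrete one. -/
instance (X : Ind C) (n : C) : PartialOrder (Pts X n) where
  le p q := p = q
  le_refl _ := rfl
  le_trans _ _ _ h h' := h.trans h'
  le_antisymm _ _ h _ := h

/-- The action `Xᵐ → Xⁿ` of a morphism `f : n ⟶ m` on points. -/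
noncomputable def Pts.map (X : Ind C) {n m : C} (f : n ⟶ m) (p : Pts X m) : Pts X n :=
  ⟨((Ind.inclusion C).obj X).map f.op p.pt⟩

/-- The component `Xⁿ → S(n)` of an `X`-type. -/
noncomputable def TypeOver.comp {S : Cᵒᵖ ⥤ KOrd.{v}} {X : Ind C} (x : TypeOver S X) (n : C) (p : Pts X n) :
    S.obj (op n) :=
  x.app (op n) p.pt

/-- A natural transformation `x : X → S` is an `ω`-saturated model if all its naturality squares

```
   Xᵐ ----> Xⁿ
   |        |
   v        v
  S(m) --> S(n)
```

have the interpolation property. -/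
def IsOmegaSaturated {S : Cᵒᵖ ⥤ KOrd.{v}} {X : Ind C} (x : TypeOver S X) : Prop :=
  ∀ {n m : C} (f : n ⟶ m),
    HasInterpolation (x.comp m) (Pts.map X f) (S.map f.op) (x.comp n)

/-- A morphism of types from `x : X → S` to `y : Y → S` is a morphism `f : X ⟶ Y` of ind-objects
whose triangle over `S` commutes laxly: `x ≤ y ∘ f` pointwise. -/
def IsTypeMorphism {S : Cᵒᵖ ⥤ KOrd.{v}} {X Y : Ind C} (x : TypeOver S X) (y : TypeOver S Y)
    (f : X ⟶ Y) : Prop :=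
  ∀ (n : C) (p : ((Ind.inclusion C).obj X).obj (op n)),
    x.comp n ⟨p⟩ ≤ y.comp n ⟨((Ind.inclusion C).map f).app (op n) p⟩

/-- A morphism of types is an elementary embedding if its triangle over `S` commutes. -/
structure IsElementaryEmbedding {S : Cᵒᵖ ⥤ KOrd.{v}} {X Y : Ind C}
    (x : TypeOver S X) (y : TypeOver S Y) (f : X ⟶ Y) : Prop where
  isTypeMorphism : IsTypeMorphism x y f
  comm : (Ind.inclusion C).map f ≫ y = x

/-- A type `x : X → S` is realized by `y : Y → S` if there is an elementary embedding from `x`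
to `y`. -/
def IsRealizedBy {S : Cᵒᵖ ⥤ KOrd.{v}} {X Y : Ind C}
    (x : TypeOver S X) (y : TypeOver S Y) : Prop :=
  ∃ f : X ⟶ Y, IsElementaryEmbedding x y f

end Polyadic

/-!
An `X`-type fails to be `ω`-saturated when some *demand* is not met: a morphism `f : n ⟶ m`, a point
`p ∈ Xⁿ` and an element `t ∈ S(m)` with `S(f)(t) ≤ x(p)`, but without any `q ∈ Xᵐ` over `p` such that
`t ≤ x(q)`. The saturated model is built by adjoining points that meet the demands.

*Meeting one demand* (`exists_elementaryExtension_solves`). Write `X` as a filtered colimit of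
objects `F i` of `C`, so that `p` is represented by some `g : n ⟶ F i₀`. The new ind-object is the
colimit, over the `i` under `i₀`, of the pushouts `m ⊔ₙ F i`. A type of it is a compatible family of
elements of the `S(m ⊔ₙ F i)`. The elements that restrict to `x` on `F i` and lie above `t` on `m`
form a closed set. It is nonempty (`IsPolyadic.exists_pushout_point`): the interpolation property
yields an element above `t` on `m` and below `x` on `F i`, and boundedness allows enlarging it until
its restriction to `F i` is exactly `x`. A cofiltered limit of nonempty compact Hausdorff spaces is
nonempty, so a compatible family exists.

*Meeting all demands of `X`* (`TypeCategory.exists_hom_solves_all`). Demands that are met remain met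
along elementary embeddings, and types with elementary embeddings form a category with filtered
colimits, so the first step can be iterated transfinitely. At each stage an unmet demand of `X` is
met; as the demands form a small set up to isomorphism, a long enough iteration meets them all
(`exists_hom_solving_all`).

*Saturation* (`TypeCategory.exists_hom_isOmegaSaturated`). The second step creates new points, hence
new demands. Iterating it `ω` times and taking the colimit settles these as well, because each point
of the colimit comes from a finite stage.
-/

universe w

open Limits

/-! ### Transfinite exhaustion of a small set of demands -/

/-- Let `P` be a small set of properties of the objects of `D`, each preserved along morphisms and
each attainable from any object by some morphism. Then every object maps to one that has all the
properties. If not, choose at each stage of a transfinite iteration a property that fails there and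
holds at the next stage; no property is chosen twice, which injects arbitrarily long well-orders
into `P`. -/
theorem exists_hom_solving_all {D : Type u} [Category.{v} D]
    (hD : ∀ (J : Type w) [LinearOrder J] [Nonempty J], HasColimitsOfShape J D)
    {P : Type w} (Sol : P → ObjectProperty D)
    (mono : ∀ (p : P) {Y Z : D}, (Y ⟶ Z) → Sol p Y → Sol p Z)
    (step : ∀ (p : P) (Y : D), ∃ Z : D, Nonempty (Y ⟶ Z) ∧ Sol p Z) (X : D) :
    ∃ Z : D, Nonempty (X ⟶ Z) ∧ ∀ p, Sol p Z := by
  have next (Y : D) : ∃ (Z : D) (_ : Y ⟶ Z),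
      (¬ ∀ p, Sol p Y) → ∃ p, ¬ Sol p Y ∧ Sol p Z := by
    by_cases h : ∀ p, Sol p Y
    · exact ⟨Y, 𝟙 Y, fun h' => (h' h).elim⟩
    · obtain ⟨p, hp⟩ := not_forall.1 h
      obtain ⟨Z, ⟨f⟩, hZ⟩ := step p Y
      exact ⟨Z, f, fun _ => ⟨p, hp, hZ⟩⟩
  choose succ toSucc hsucc using next
  let Φ : SmallObject.SuccStruct D := ⟨X, succ, toSucc⟩
  -- a well-ordered type without greatest element that does not inject into `P`
  let κ : Cardinal.{w} := max Cardinal.aleph0 (Order.succ (Cardinal.mk P))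
  have hκ : Cardinal.aleph0 ≤ κ := le_max_left _ _
  let J : Type w := κ.ord.ToType
  have : NoMaxOrder J := Cardinal.noMaxOrder hκ
  have : Nonempty J := by
    rw [← Cardinal.mk_ne_zero_iff, Cardinal.mk_ord_toType]
    exact (Cardinal.aleph0_pos.trans_le hκ).ne'
  let : OrderBot J := WellFoundedLT.toOrderBot J
  let : SuccOrder J := SuccOrder.ofLinearWellFoundedLT J
  have : HasIterationOfShape J D :=
    { hasColimitsOfShape_of_isSuccLimit := fun j hj => by
        have : Nonempty (Set.Iio j) := ⟨⟨⊥, hj.bot_lt⟩⟩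
        exact hD _
      hasColimitsOfShape := hD J }
  let F := Φ.iterationFunctor J
  by_contra! hno
  have hF (j : J) : ¬ ∀ p, Sol p (F.obj j) := fun h => by
    obtain ⟨p, hp⟩ := hno (F.obj j) ⟨(Φ.ιIterationFunctor J).app j⟩
    exact hp (h p)
  -- `c j` fails at stage `j` and holds at all later stages
  choose c hc hc' using fun j => hsucc (F.obj j) (hF j)
  have hlt {i j : J} (h : i < j) : c i ≠ c j := fun e => by
    apply hc j
    rw [← e]
    exact mono _ ((Φ.iterationFunctorObjSuccIso i (not_isMax i)).inv ≫
      F.map (homOfLE (Order.succ_le_of_lt h))) (hc' i)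
  have hinj : Function.Injective c := fun i j e => by
    rcases lt_trichotomy i j with h | h | h
    · exact (hlt h e).elim
    · exact h
    · exact (hlt h e.symm).elim
  have := Cardinal.mk_le_of_injective hinj
  rw [Cardinal.mk_ord_toType] at this
  exact ((Order.lt_succ _).trans_le ((le_max_right _ _).trans this)).false

/-! ### Elements of a polyadic space over a pushout -/

section

variable {C : Type u} [Category.{v} C]

/-- Amalgamation over a pushout, with equality on one side: interpolation gives an element whose
restriction to `k` is at most `s`, and boundedness moves it up to one that restricts to `s`. -/
theorem IsPolyadic.exists_pushout_point [HasPushouts C] {S : Cᵒᵖ ⥤ KOrd.{v}} (hS : IsPolyadic S)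
    {n m k : C} (f : n ⟶ m) (g : n ⟶ k) (t : S.obj (op m)) (s : S.obj (op k))
    (h : S.map f.op t ≤ S.map g.op s) :
    ∃ r : S.obj (op (pushout f g)),
      t ≤ S.map (pushout.inl f g).op r ∧ S.map (pushout.inr f g).op r = s := by
  obtain ⟨r, hr, hr'⟩ := hS.interpolation (IsPushout.of_hasPushout f g) t s h
  obtain ⟨r', hr₁, hr₂⟩ :=
    hS.bounded (pushout.inr f g) (Set.Ici r) (isUpperSet_Ici r) hr' ⟨r, le_rfl, rfl⟩
  exact ⟨r', hr.trans ((S.map (pushout.inl f g).op).hom'.monotone hr₁), hr₂⟩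

theorem KOrd.map_map (S : Cᵒᵖ ⥤ KOrd.{v}) {a b c : C} (f : a ⟶ b) (g : b ⟶ c) (s : S.obj (op c)) :
    S.map f.op (S.map g.op s) = S.map (f ≫ g).op s := by
  rw [op_comp, S.map_comp]; rfl

theorem TypeOver.app_map {S : Cᵒᵖ ⥤ KOrd.{v}} {A : Cᵒᵖ ⥤ Type v}
    (x : A ⟶ S ⋙ forget KOrd.{v}) {n m : C} (f : n ⟶ m) (p : A.obj (op m)) :
    (x.app _ (A.map f.op p) : S.obj (op n)) = S.map f.op (x.app _ p : S.obj (op m)) :=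
  ConcreteCategory.congr_hom (x.naturality f.op) p

theorem KOrd.continuous_map (S : Cᵒᵖ ⥤ KOrd.{v}) {a b : C} (f : a ⟶ b) :
    Continuous (S.map f.op) :=
  map_continuous (S.map f.op).hom'

/-! ### Compatible families by compactness -/

/-- The elements of `S(G i)` lying above `t` along `β` and restricting to `s i` along `α` form
nonempty closed sets, so a compatible family of them exists by compactness. -/
theorem exists_compatible_family {S : Cᵒᵖ ⥤ KOrd.{v}}
    {I : Type v} [SmallCategory I] [IsFiltered I] (F G : I ⥤ C) (α : F ⟶ G)
    {m : C} (β : (Functor.const I).obj m ⟶ G) (t : S.obj (op m))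
    (s : ∀ i, S.obj (op (F.obj i)))
    (ne : ∀ i, ∃ r : S.obj (op (G.obj i)), t ≤ S.map (β.app i).op r ∧ S.map (α.app i).op r = s i)
    (hs : ∀ {i j : I} (a : i ⟶ j), S.map (F.map a).op (s j) = s i) :
    ∃ r : ∀ i, S.obj (op (G.obj i)), (∀ {i j : I} (a : i ⟶ j), S.map (G.map a).op (r j) = r i) ∧
      ∀ i, t ≤ S.map (β.app i).op (r i) ∧ S.map (α.app i).op (r i) = s i := by
  let K (i : I) : Set (S.obj (op (G.obj i))) :=
    {r | t ≤ S.map (β.app i).op r ∧ S.map (α.app i).op r = s i}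
  have hK {i j : I} (a : i ⟶ j) {r} (hr : r ∈ K j) : S.map (G.map a).op r ∈ K i := by
    refine ⟨?_, ?_⟩
    · rw [KOrd.map_map, ← β.naturality a]
      simpa using hr.1
    · rw [KOrd.map_map, ← α.naturality a, ← KOrd.map_map, hr.2, hs]
  let Q : Iᵒᵖ ⥤ TopCat.{v} :=
    { obj i := TopCat.of (K i.unop)
      map a := TopCat.ofHom ⟨fun r => ⟨S.map (G.map a.unop).op r.1, hK a.unop r.2⟩, by
        exact ((KOrd.continuous_map S (G.map a.unop)).comp continuous_subtype_val).subtype_mk _⟩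
      map_id i := by
        ext r
        change S.map (G.map (𝟙 _)).op r.1 = r.1
        rw [G.map_id, op_id, S.map_id]; rfl
      map_comp a b := by
        ext r
        change S.map (G.map (b.unop ≫ a.unop)).op r.1 =
          S.map (G.map b.unop).op (S.map (G.map a.unop).op r.1)
        rw [G.map_comp, KOrd.map_map] }
  have closed (i : I) : IsClosed (K i) :=
    (isClosed_le continuous_const (KOrd.continuous_map S (β.app i))).inter
      (isClosed_eq (KOrd.continuous_map S (α.app i)) continuous_const)
  have : ∀ i, Nonempty (Q.obj i) := fun i => by
    obtain ⟨r, hr⟩ := ne i.unop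
    exact ⟨⟨r, hr⟩⟩
  have : ∀ i, CompactSpace (Q.obj i) := fun i =>
    isCompact_iff_compactSpace.1 (closed i.unop).isCompact
  have : ∀ i, T2Space (Q.obj i) := fun i => inferInstanceAs (T2Space (K i.unop))
  obtain ⟨r, hr⟩ := TopCat.nonempty_limitCone_of_compact_t2_cofiltered_system Q
  exact ⟨fun i => (r (op i)).1, fun a => congrArg Subtype.val (hr a.op), fun i => (r (op i)).2⟩

/-- By the Yoneda lemma, a compatible family of elements of `S(G i)` is a type of the ind-object
presented by `G`. -/
theorem exists_hom_of_family {S : Cᵒᵖ ⥤ KOrd.{v}} {I : Type v} [SmallCategory I]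
    {G : I ⥤ C} {c : Cocone (G ⋙ yoneda)} (hc : IsColimit c)
    (r : ∀ i, S.obj (op (G.obj i)))
    (hr : ∀ {i j : I} (a : i ⟶ j), S.map (G.map a).op (r j) = r i) :
    ∃ y : c.pt ⟶ S ⋙ forget KOrd.{v}, ∀ i {n : C} (a : n ⟶ G.obj i),
      (y.app (op n) ((c.ι.app i).app (op n) a) : S.obj (op n)) = S.map a.op (r i) := by
  let d : Cocone (G ⋙ yoneda) :=
    { pt := S ⋙ forget KOrd.{v}
      ι :=
        { app i := yonedaEquiv.symm (r i)
          naturality i j a := by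
            ext n b
            exact (KOrd.map_map S b (G.map a) (r j)).symm.trans
              (congrArg (S.map b.op) (hr a)) } }
  refine ⟨hc.desc d, fun i n a => ?_⟩
  have := NatTrans.congr_app (hc.fac d i) (op n)
  have := ConcreteCategory.congr_hom this a
  exact this

/-! ### Meeting one demand -/

/-- The type `x` meets the demand `(f, p, t)`: there is a point over `p` along `f` whose type is
above `t`. The condition `S(f)(t) ≤ x(p)`, without which this cannot hold, is not part of the
definition. -/
def Solves {S : Cᵒᵖ ⥤ KOrd.{v}} {A : Cᵒᵖ ⥤ Type v} (x : A ⟶ S ⋙ forget KOrd.{v}) {n m : C}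
    (f : n ⟶ m) (p : A.obj (op n)) (t : S.obj (op m)) : Prop :=
  ∃ q : A.obj (op m), A.map f.op q = p ∧ t ≤ (x.app (op m) q : S.obj (op m))

/-- The diagram `i ↦ m ⊔ₙ F i` of pushouts of `f : n ⟶ m` along the composites of
`g : n ⟶ F i₀` with the transition maps `F i₀ ⟶ F i`, indexed by the `i` under `i₀`. -/
noncomputable def underPushout [HasPushouts C] {I : Type v} [SmallCategory I] (F : I ⥤ C)
    {n m : C} (f : n ⟶ m) {i₀ : I} (g : n ⟶ F.obj i₀) : Under i₀ ⥤ C where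
  obj i := pushout f (g ≫ F.map i.hom)
  map a := pushout.desc (pushout.inl _ _) (F.map a.right ≫ pushout.inr _ _) (by
    rw [pushout.condition, Category.assoc, Category.assoc, ← F.map_comp_assoc, Under.w])
  map_id i := by ext <;> simp
  map_comp a b := by
    refine pushout.hom_ext ?_ ?_
    · simp only [← Category.assoc, pushout.inl_desc]
    · simp only [← Category.assoc, pushout.inr_desc]
      simp only [Category.assoc, pushout.inr_desc, Under.comp_right, Functor.map_comp]

/-- Every demand `(f, p, t)` with `S(f)(t) ≤ x(p)` is met by some elementary extension of `x`. The
underlying ind-object constructed here is the pushout of `f` along `p`. -/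
theorem exists_elementaryExtension_solves [HasPushouts C] {S : Cᵒᵖ ⥤ KOrd.{v}} (hS : IsPolyadic S)
    {A : Cᵒᵖ ⥤ Type v} (hA : IsIndObject A) (x : A ⟶ S ⋙ forget KOrd.{v}) {n m : C}
    (f : n ⟶ m) (p : A.obj (op n)) (t : S.obj (op m))
    (h : S.map f.op t ≤ (x.app (op n) p : S.obj (op n))) :
    ∃ (B : Cᵒᵖ ⥤ Type v) (_ : IsIndObject B) (η : A ⟶ B) (y : B ⟶ S ⋙ forget KOrd.{v}),
      η ≫ y = x ∧ Solves y f (η.app (op n) p) t := by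
  obtain ⟨⟨P⟩⟩ := hA
  obtain ⟨i₀, g, rfl⟩ : ∃ (i₀ : P.I) (g : n ⟶ P.F.obj i₀), (P.ι.app i₀).app (op n) g = p :=
    Types.jointly_surjective _ (isColimitOfPreserves ((evaluation _ _).obj (op n)) P.isColimit) p
  let U := Under.forget i₀
  let G := underPushout P.F f g
  let α : U ⋙ P.F ⟶ G :=
    { app i := pushout.inr _ _
      naturality i j a := (pushout.inr_desc _ _ _).symm }
  let β : (Functor.const _).obj m ⟶ G :=
    { app i := pushout.inl _ _
      naturality i j a := (Category.id_comp _).trans (pushout.inl_desc _ _ _).symm }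
  -- the type `x` as a compatible family: `s i` is the value of `x` at the generic point of `F i`
  let s (i : Under i₀) : S.obj (op (P.F.obj i.right)) := x.app _ ((P.ι.app i.right).app _ (𝟙 _))
  have hι {i j : P.I} (a : i ⟶ j) {k : C} (b : k ⟶ P.F.obj i) :
      (P.ι.app j).app (op k) (b ≫ P.F.map a) = (P.ι.app i).app (op k) b :=
    ConcreteCategory.congr_hom (NatTrans.congr_app (P.ι.naturality a) (op k)) b
  have hb {i : P.I} {k l : C} (b : k ⟶ P.F.obj i) (c : l ⟶ k) :
      A.map c.op ((P.ι.app i).app (op k) b) = (P.ι.app i).app (op l) (c ≫ b) :=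
    (ConcreteCategory.congr_hom ((P.ι.app i).naturality c.op) b).symm
  have hx {i : P.I} {k : C} (b : k ⟶ P.F.obj i) :
      S.map b.op (x.app _ ((P.ι.app i).app _ (𝟙 _)) : S.obj (op (P.F.obj i))) =
        (x.app _ ((P.ι.app i).app _ b) : S.obj (op k)) := by
    rw [← TypeOver.app_map, hb, Category.comp_id]
  have ne (i : Under i₀) := hS.exists_pushout_point f (g ≫ P.F.map i.hom) t (s i) (by
    rw [hx]
    exact h.trans_eq (congrArg (x.app (op n)) (hι i.hom g).symm))
  obtain ⟨r, hr, hr'⟩ := exists_compatible_family (U ⋙ P.F) G α β t s ne (fun {i j} a => by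
    refine (hx (P.F.map a.right)).trans (congrArg (x.app _) ?_)
    rw [← hι a.right (𝟙 _), Category.id_comp])
  obtain ⟨y, hy⟩ := exists_hom_of_family (colimit.isColimit (G ⋙ yoneda)) r hr
  -- restricting the presentation of `A` to the indices under `i₀` does not change its colimit
  let e := (Functor.Final.isColimitWhiskerEquiv U _).symm P.isColimit
  let η : A ⟶ colimit (G ⋙ yoneda) := e.desc
      ((Cocone.precompose (Functor.whiskerRight α yoneda)).obj (colimit.cocone (G ⋙ yoneda)))
  have hη (i : Under i₀) {k : C} (b : k ⟶ P.F.obj i.right) :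
      η.app _ ((P.ι.app i.right).app (op k) b) =
        (colimit.ι (G ⋙ yoneda) i).app (op k) (b ≫ α.app i) :=
    ConcreteCategory.congr_hom (NatTrans.congr_app (e.fac _ i) (op k)) b
  refine ⟨colimit (G ⋙ yoneda), ⟨⟨.ofCocone _ (colimit.isColimit (G ⋙ yoneda))⟩⟩, η, y, ?_, ?_⟩
  · refine e.hom_ext fun i => ?_
    ext ⟨k⟩ b
    change (y.app _ (η.app _ ((P.ι.app i.right).app (op k) b)) : S.obj (op k)) =
      x.app _ ((P.ι.app i.right).app (op k) b)
    refine (congrArg (y.app _) (hη i b)).trans ((hy i (b ≫ α.app i)).trans ?_)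
    rw [← KOrd.map_map, (hr' i).2]
    exact hx b
  · let i : Under i₀ := Under.mk (𝟙 i₀)
    refine ⟨(colimit.ι (G ⋙ yoneda) i).app (op m) (β.app i), ?_, ?_⟩
    · refine (ConcreteCategory.congr_hom ((colimit.ι (G ⋙ yoneda) i).naturality f.op)
        (β.app i)).symm.trans ?_
      refine Eq.trans ?_ (hη i g).symm
      have : f ≫ β.app i = g ≫ α.app i := by
        refine (pushout.condition (f := f) (g := g ≫ P.F.map i.hom)).trans ?_
        change (g ≫ P.F.map (𝟙 i₀)) ≫ _ = _
        rw [P.F.map_id, Category.comp_id]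
        rfl
      exact congrArg ((colimit.ι (G ⋙ yoneda) i).app (op n)) this
    · exact (hr' i).1.trans_eq (hy i (β.app i)).symm

section Transport

variable {S : Cᵒᵖ ⥤ KOrd.{v}} {A B : Cᵒᵖ ⥤ Type v}

theorem Solves.map {x : A ⟶ S ⋙ forget KOrd.{v}} {y : B ⟶ S ⋙ forget KOrd.{v}} (η : A ⟶ B)
    (h : η ≫ y = x) {n m : C} {f : n ⟶ m} {p : A.obj (op n)} {t : S.obj (op m)}
    (hp : Solves x f p t) : Solves y f (η.app (op n) p) t := by
  subst h
  obtain ⟨q, rfl, ht⟩ := hp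
  exact ⟨η.app (op m) q, (ConcreteCategory.congr_hom (η.naturality f.op) q).symm, ht⟩

/-- Demands may be replaced by isomorphic ones, so it suffices to meet those between objects of a
small model of `C`. -/
theorem Solves.of_iso {x : A ⟶ S ⋙ forget KOrd.{v}} {n n' m m' : C} (α : n' ≅ n) (β : m' ≅ m)
    {f : n ⟶ m} {p : A.obj (op n)} {t : S.obj (op m)}
    (h : Solves x (α.hom ≫ f ≫ β.inv) (A.map α.hom.op p) (S.map β.hom.op t)) :
    Solves x f p t := by
  obtain ⟨q, hq, ht⟩ := h
  have hmap {a b c : C} (f : a ⟶ b) (g : b ⟶ c) (r : A.obj (op c)) :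
      A.map f.op (A.map g.op r) = A.map (f ≫ g).op r := by simp
  refine ⟨A.map β.inv.op q, ?_, ?_⟩
  · have := congrArg (A.map α.inv.op) hq
    rw [hmap, hmap, α.inv_hom_id, op_id, A.map_id] at this
    rwa [α.inv_hom_id_assoc, ← hmap] at this
  · rw [TypeOver.app_map]
    have := (S.map β.inv.op).hom'.monotone ht
    refine le_trans (le_of_eq ?_) this
    refine Eq.symm ((KOrd.map_map S β.inv β.hom t).trans ?_)
    rw [β.inv_hom_id, op_id, S.map_id]; rfl

end Transport

/-! ### The category of types and elementary embeddings -/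

/-- The category of types of `S` over varying ind-objects, with elementary embeddings as morphisms:
the condition of `IsElementaryEmbedding` that morphisms of types satisfy `x ≤ y ∘ f` is implied by
the commutation of the triangle. -/
noncomputable abbrev TypeCategory (S : Cᵒᵖ ⥤ KOrd.{v}) :=
  CostructuredArrow (Ind.inclusion C) (S ⋙ forget KOrd.{v})

/-- The type underlying an object of `TypeCategory S`. -/
noncomputable abbrev TypeCategory.type {S : Cᵒᵖ ⥤ KOrd.{v}} (X : TypeCategory S) :
    TypeOver S X.left :=
  X.hom

/-- The action of an elementary embedding on `n`-points. -/
noncomputable abbrev TypeCategory.app {S : Cᵒᵖ ⥤ KOrd.{v}} {X Y : TypeCategory S} (h : X ⟶ Y)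
    (n : C) (p : ((Ind.inclusion C).obj X.left).obj (op n)) :
    ((Ind.inclusion C).obj Y.left).obj (op n) :=
  ((Ind.inclusion C).map h.left).app (op n) p

variable {S : Cᵒᵖ ⥤ KOrd.{v}}

namespace TypeCategory

theorem w {X Y : TypeCategory S} (h : X ⟶ Y) :
    (Ind.inclusion C).map h.left ≫ Y.type = X.type := CostructuredArrow.w h

theorem type_app {X Y : TypeCategory S} (h : X ⟶ Y) (n : C)
    (p : ((Ind.inclusion C).obj X.left).obj (op n)) :
    Y.type.app (op n) (app h n p) = X.type.app (op n) p :=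
  ConcreteCategory.congr_hom (NatTrans.congr_app (w h) (op n)) p

theorem app_comp {X Y Z : TypeCategory S} (h : X ⟶ Y) (k : Y ⟶ Z) (n : C)
    (p : ((Ind.inclusion C).obj X.left).obj (op n)) :
    app (h ≫ k) n p = app k n (app h n p) := by
  simp [app]

theorem exists_hom_solves [HasPushouts C] (hS : IsPolyadic S) (X : TypeCategory S) {n m : C}
    (f : n ⟶ m) (p : ((Ind.inclusion C).obj X.left).obj (op n)) (t : S.obj (op m))
    (h : S.map f.op t ≤ (X.type.app (op n) p : S.obj (op n))) :
    ∃ (Y : TypeCategory S) (k : X ⟶ Y), Solves Y.type f (app k n p) t := by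
  obtain ⟨B, hB, η, y, hη, hy⟩ :=
    exists_elementaryExtension_solves hS X.left.isIndObject_inclusion_obj X.type f p t h
  let Y : Ind C := (Ind.equivalence C).inverse.obj ⟨B, hB⟩
  let e : (Ind.inclusion C).obj Y ≅ B :=
    (ObjectProperty.ι _).mapIso ((Ind.equivalence C).counitIso.app ⟨B, hB⟩)
  obtain ⟨k, hk⟩ := (Ind.inclusion C).map_surjective (X := X.left) (Y := Y) (η ≫ e.inv)
  let k' : X ⟶ CostructuredArrow.mk (Y := Y) (e.hom ≫ y) := CostructuredArrow.homMk k (by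
    change (Ind.inclusion C).map k ≫ e.hom ≫ y = _
    rw [hk, Category.assoc, e.inv_hom_id_assoc]
    exact hη)
  refine ⟨_, k', ?_⟩
  have : app k' n p = e.inv.app (op n) (η.app (op n) p) :=
    ConcreteCategory.congr_hom (NatTrans.congr_app hk (op n)) p
  rw [this]
  exact hy.map (y := e.hom ≫ y) e.inv (e.inv_hom_id_assoc y)

/-- Some elementary extension of `X` meets all demands of `X` itself, though possibly not those at
its new points. -/
theorem exists_hom_solves_all [EssentiallySmall.{v} C] [HasPushouts C] (hS : IsPolyadic S)
    (X : TypeCategory S) :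
    ∃ (Y : TypeCategory S) (k : X ⟶ Y), ∀ {n m : C} (f : n ⟶ m)
      (p : ((Ind.inclusion C).obj X.left).obj (op n)) (t : S.obj (op m)),
      S.map f.op t ≤ (X.type.app (op n) p : S.obj (op n)) → Solves Y.type f (app k n p) t := by
  let e : SmallModel.{v} C ⥤ C := (equivSmallModel C).inverse
  -- the small set of demands of `X` between objects of the small model of `C`
  let P : Type v := Σ (n m : SmallModel.{v} C), (e.obj n ⟶ e.obj m) ×
    ((Ind.inclusion C).obj X.left).obj (op (e.obj n)) × S.obj (op (e.obj m))
  -- meeting a demand is a property of types under `X`: the structure map locates the points of `X`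
  let Sol (a : P) : ObjectProperty (Under X) := fun Y =>
    S.map a.2.2.1.op a.2.2.2.2 ≤ (X.type.app _ a.2.2.2.1 : S.obj (op (e.obj a.1))) →
      Solves Y.right.type a.2.2.1 (app Y.hom _ a.2.2.2.1) a.2.2.2.2
  obtain ⟨Z, -, hZ⟩ := exists_hom_solving_all (D := Under X) (fun J _ _ => inferInstance) Sol
    (fun a Y Z k hY ha => by
      have := (hY ha).map _ (w k.right)
      have he : app Z.hom _ a.2.2.2.1 = app k.right _ (app Y.hom _ a.2.2.2.1) := by
        rw [← app_comp]
        exact congrArg (fun h => app h _ a.2.2.2.1) (Under.w k).symm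
      rw [he]
      exact this)
    (fun a Y => by
      by_cases ha : S.map a.2.2.1.op a.2.2.2.2 ≤
        (X.type.app _ a.2.2.2.1 : S.obj (op (e.obj a.1)))
      · obtain ⟨Z, k, hk⟩ := exists_hom_solves hS Y.right a.2.2.1 (app Y.hom _ a.2.2.2.1) a.2.2.2.2
          (ha.trans_eq (type_app Y.hom _ a.2.2.2.1).symm)
        refine ⟨Under.mk (Y.hom ≫ k), ⟨Under.homMk k⟩, fun _ => ?_⟩
        have := app_comp Y.hom k _ a.2.2.2.1
        exact this ▸ hk
      · exact ⟨Y, ⟨𝟙 Y⟩, fun ha' => (ha ha').elim⟩) (Under.mk (𝟙 X))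
  refine ⟨Z.right, Z.hom, fun {n m} f p t h => ?_⟩
  let α := e.objObjPreimageIso n
  let β := e.objObjPreimageIso m
  refine Solves.of_iso α β ?_
  have := hZ ⟨_, _, α.hom ≫ f ≫ β.inv, ((Ind.inclusion C).obj X.left).map α.hom.op p,
    S.map β.hom.op t⟩ (by
      dsimp only
      rw [KOrd.map_map, TypeOver.app_map]
      simp only [Category.assoc, Iso.inv_hom_id, Category.comp_id]
      rw [← KOrd.map_map]
      exact (S.map α.hom.op).hom'.monotone h)
  have he : app Z.hom _ (((Ind.inclusion C).obj X.left).map α.hom.op p) =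
      ((Ind.inclusion C).obj Z.right.left).map α.hom.op (app Z.hom _ p) :=
    ConcreteCategory.congr_hom (((Ind.inclusion C).map Z.hom.left).naturality α.hom.op) p
  exact he ▸ this

/-! ### Saturation -/

theorem exists_hom_isOmegaSaturated [EssentiallySmall.{v} C] [HasPushouts C] (hS : IsPolyadic S)
    (X : TypeCategory S) :
    ∃ (Y : TypeCategory S) (_ : X ⟶ Y), IsOmegaSaturated Y.type := by
  choose next k hk using fun X : TypeCategory S => exists_hom_solves_all hS X
  let s : ℕ → TypeCategory S := Nat.rec X fun _ Y => next Y
  let F : ℕ ⥤ TypeCategory S := Functor.ofSequence (X := s) fun i => k (s i)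
  -- `ℕ` is replaced by a copy in the universe of the filtered colimits available in `Ind C`
  have : IsFiltered (AsSmall.{v} ℕ) := .of_equivalence AsSmall.equiv
  have : HasColimitsOfShape ℕ (Ind C) :=
    hasColimitsOfShape_of_equivalence (J := AsSmall.{v} ℕ) AsSmall.equiv.symm
  have : PreservesColimitsOfShape ℕ (Ind.inclusion C) :=
    preservesColimitsOfShape_of_equiv (J := AsSmall.{v} ℕ) AsSmall.equiv.symm _
  refine ⟨colimit F, colimit.ι F 0, fun {n m} f t ⟨p⟩ h => ?_⟩
  obtain ⟨i, p, rfl⟩ : ∃ i p, app (colimit.ι F i) n p = _ := Types.jointly_surjective _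
    (isColimitOfPreserves (CostructuredArrow.proj _ _ ⋙ Ind.inclusion C ⋙
      (evaluation _ _).obj (op n)) (colimit.isColimit F)) p
  -- a demand at a point of stage `i` is met at stage `i + 1`
  have hp := hk (s i) f p t (h.trans_eq (type_app (colimit.ι F i) n p))
  have hi : k (s i) ≫ colimit.ι F (i + 1) = colimit.ι F i := by
    rw [← colimit.w F (homOfLE (Nat.le_add_right i 1)), Functor.ofSequence_map_homOfLE_succ]
    rfl
  obtain ⟨q, hq, ht⟩ := hp.map _ (w (colimit.ι F (i + 1)))
  refine ⟨⟨q⟩, ht, congrArg Pts.mk (hq.trans ?_)⟩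
  exact (app_comp _ _ n p).symm.trans (congrArg (fun h => app h n p) hi)

end TypeCategory

end

theorem mainTheorem4 {C : Type u} [Category.{v} C] [EssentiallySmall.{v} C]
    [Limits.HasPushouts C] (S : Cᵒᵖ ⥤ KOrd.{v}) (hS : IsPolyadic S)
    (X : Ind C) (x : TypeOver S X) :
    ∃ (Y : Ind C) (y : TypeOver S Y), IsOmegaSaturated y ∧ IsRealizedBy x y := by
  obtain ⟨Y, k, hY⟩ := TypeCategory.exists_hom_isOmegaSaturated hS (CostructuredArrow.mk x)
  exact ⟨Y.left, Y.type, hY, k.left, fun n p => le_of_eq (TypeCategory.type_app k n p).symm,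
    TypeCategory.w k⟩
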